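/- Consider bimatrix games $(A,B)$, $A,B\in\mathbb{R}^{n\times n}$, with strategy set $[n]=\{1,\dots,n\}$ for each player; the rank of the game is $\operatorname{rank}(A+B)$. A data set $T$ over the $n\times n$ strategy space is a set of observations $((i,j),I,J)$ with $i\in I\subseteq[n]$, $j\in J\subseteq[n]$. The pair $(I,J)$ is called a subgame in $T$ and $(i,j)$ is an observed choice in it. The game $(A,B)$ rationalizes $T$ if for every $((i,j),I,J)\in T$ the pair $(i,j)$ is a strict pure Nash equilibrium of the subgame $(I,J)$, i.e. $A_{ij}>A_{i'j}$ for all $i'\in I\setminus\{i\}$ and $B_{ij}>B_{ij'}$ for all $j'\in J\setminus\{j\}$; $T$ is rationalizable if some game rationalizes it. Two subgames $(I,J)$, $(I',J')$ cross if $I\times J$ and $I'\times J'$ intersect and neither contains the other; $T$ is laminar if no two subgames in $T$ cross. A rationalizable data set $T$ has the uniqueness property if every subgame in $T$ has exactly one observed choice and, whenever $((i,j),I,J),((i',j'),I',J')\in T$ with $I'\times J'\subseteq I\times J$ and $(i,j)\in I'\times J'$, then $(i',j')=(i,j)$. Put $R_i=\{2i-1,2i\}$ for $1\le i\le\lfloor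 n/2\rfloor$. The data set $T$ is 2-regular if its subgames are exactly the blocks $(R_i,R_j)$ with $1\le i,j\le\lfloor n/2\rfloor$, and in each block $(R_i,R_j)$ either both diagonal choices $(2i-1,2j-1),(2i,2j)$ or both off-diagonal choices $(2i-1,2j),(2i,2j-1)$ are observed, but not both pairs. Its sign-pattern matrix has $(i,j)$ entry $+1$ in the first case and $-1$ in the second. The Sylvester–Hadamard matrices are $H_1=[1]$ and $H_{2m}=\begin{bmatrix}H_m&H_m\\H_m&-H_m\end{bmatrix}$ for $m$ a power of $2$; each is a leading principal submatrix of the next. **Theorem.** There is an absolute constant $c>0$ such that for every $n\ge 2$ there is a rationalizable data set $T$ over the $n\times n$ strategy space such that every bimatrix game that rationalizes $T$ has rank at least $c\sqrt n$. Moreover $T$ can be taken laminar and 2-regular, with sign-pattern matrix the leading principal $\lfloor n/2\rfloor\times\lfloor n/2\rfloor$ submatrix of the Sylvester–Hadamard matrices of order at least $\lfloor n/2\rfloor$ (so exactly $H_{n/2}$ when $n$ is a power of $2$). Furthermore, let $T'$ be obtained from $T$ by replacing the two observations in each block $(R_i,R_j)$ by the three observations $$((2i-1,2j-1),R_i,R_j),\quad((2i,2j),R_i,\{2j\}),\quad((2i,2j),\{2i\},R_j)$$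 if the diagonal pair is observed, and by $$((2i-1,2j),R_i,R_j),\quad((2i,2j-1),R_i,\{2j-1\}),\quad((2i,2j-1),\{2i\},R_j)$$ if the off-diagonal pair is observed. Then $T'$ is rationalizable, has the uniqueness property, is not laminar, and every bimatrix game that rationalizes $T'$ has rank at least $c\sqrt n$. -/

import Mathlib

open scoped Matrix

/-- A data set over an `n × n` strategy space: a set of observations `((i, j), I, J)`, where
`I` and `J` are the strategies available to the row and to the column player and `(i, j)` is the
choice observed in the subgame `(I, J)`. -/
structure DataSet (n : ℕ) where
  obs : Set ((Fin n × Fin n) × Finset (Fin n) × Finset (Fin n))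
  mem_rows : ∀ {i j : Fin n} {I J : Finset (Fin n)}, ((i, j), I, J) ∈ obs → i ∈ I
  mem_cols : ∀ {i j : Fin n} {I J : Finset (Fin n)}, ((i, j), I, J) ∈ obs → j ∈ J

/-- `(i, j)` is a pure strict Nash equilibrium of the subgame `(I, J)` of the bimatrix game with
payoff matrices `A` (row player) and `B` (column player). -/
def IsStrictNash {n : ℕ} (A B : Matrix (Fin n) (Fin n) ℝ) (i j : Fin n)
    (I J : Finset (Fin n)) : Prop :=
  i ∈ I ∧ j ∈ J ∧ (∀ i' ∈ I, i' ≠ i → A i' j < A i j) ∧ (∀ j' ∈ J, j' ≠ j → B i j' < B i j)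

/-- The two subgames `(I, J)` and `(I', J')` cross. -/
def SubgamesCross {n : ℕ} (I J I' J' : Finset (Fin n)) : Prop :=
  ((I ×ˢ J) ∩ (I' ×ˢ J')).Nonempty ∧ ¬ (I ×ˢ J) ⊆ (I' ×ˢ J') ∧ ¬ (I' ×ˢ J') ⊆ (I ×ˢ J)

/-- First strategy of the `i`-th pair of consecutive strategies (`2i - 1` when counting
strategies and pairs from 1). -/
def pairFst {n : ℕ} (i : Fin (n / 2)) : Fin n := ⟨2 * i.val, by omega⟩

/-- Second strategy of the `i`-th pair of consecutive strategies (`2i` when counting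
strategies and pairs from 1). -/
def pairSnd {n : ℕ} (i : Fin (n / 2)) : Fin n := ⟨2 * i.val + 1, by omega⟩

/-- The `i`-th pair of consecutive strategies. -/
def pairSet {n : ℕ} (i : Fin (n / 2)) : Finset (Fin n) := {pairFst i, pairSnd i}

/-- The Sylvester-Hadamard matrix of order `2 ^ k`: `H₁ = [1]` and
`H_{2m} = [[H_m, H_m], [H_m, -H_m]]`. -/
def sylvesterHadamard : (k : ℕ) → Matrix (Fin (2 ^ k)) (Fin (2 ^ k)) ℤ
  | 0 => Matrix.of fun _ _ => 1
  | k + 1 =>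
    let e : Fin (2 ^ k) ⊕ Fin (2 ^ k) ≃ Fin (2 ^ (k + 1)) :=
      finSumFinEquiv.trans (finCongr (by rw [pow_succ, mul_two]))
    Matrix.reindex e e
      (Matrix.fromBlocks (sylvesterHadamard k) (sylvesterHadamard k)
        (sylvesterHadamard k) (-sylvesterHadamard k))

/-- The three observations that replace the diagonal pair observed in a block. -/
def diagTriple {n : ℕ} (i j : Fin (n / 2)) :
    Set ((Fin n × Fin n) × Finset (Fin n) × Finset (Fin n)) :=
  {((pairFst i, pairFst j), pairSet i, pairSet j),
   ((pairSnd i, pairSnd j), pairSet i, {pairSnd j}),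
   ((pairSnd i, pairSnd j), {pairSnd i}, pairSet j)}

/-- The three observations that replace the off-diagonal pair observed in a block. -/
def offDiagTriple {n : ℕ} (i j : Fin (n / 2)) :
    Set ((Fin n × Fin n) × Finset (Fin n) × Finset (Fin n)) :=
  {((pairFst i, pairSnd j), pairSet i, pairSet j),
   ((pairSnd i, pairFst j), pairSet i, {pairFst j}),
   ((pairSnd i, pairFst j), {pairSnd i}, pairSet j)}

namespace DataSet

variable {n : ℕ}

/-- The bimatrix game `(A, B)` rationalizes `T`. -/
def RationalizedBy (T : DataSet n) (A B : Matrix (Fin n) (Fin n) ℝ) : Prop :=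
  ∀ (i j : Fin n) (I J : Finset (Fin n)), ((i, j), I, J) ∈ T.obs → IsStrictNash A B i j I J

def Rationalizable (T : DataSet n) : Prop :=
  ∃ A B : Matrix (Fin n) (Fin n) ℝ, T.RationalizedBy A B

/-- The subgame `(I, J)` appears in `T`. -/
def HasSubgame (T : DataSet n) (I J : Finset (Fin n)) : Prop :=
  ∃ p : Fin n × Fin n, (p, I, J) ∈ T.obs

/-- No two subgames in `T` cross. -/
def Laminar (T : DataSet n) : Prop :=
  ∀ I J I' J' : Finset (Fin n), T.HasSubgame I J → T.HasSubgame I' J' →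
    ¬ SubgamesCross I J I' J'

/-- The uniqueness property of a rationalizable data set. -/
def HasUniqueness (T : DataSet n) : Prop :=
  T.Rationalizable ∧
  (∀ I J : Finset (Fin n), T.HasSubgame I J → ∃! p : Fin n × Fin n, (p, I, J) ∈ T.obs) ∧
  (∀ (i j : Fin n) (I J : Finset (Fin n)) (i' j' : Fin n) (I' J' : Finset (Fin n)),
    ((i, j), I, J) ∈ T.obs → ((i', j'), I', J') ∈ T.obs →
    (I' ×ˢ J') ⊆ (I ×ˢ J) → (i, j) ∈ I' ×ˢ J' → (i', j') = (i, j))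

/-- Both diagonal choices of the block `(i, j)` are observed in that `2 × 2` subgame. -/
def DiagObserved (T : DataSet n) (i j : Fin (n / 2)) : Prop :=
  ((pairFst i, pairFst j), pairSet i, pairSet j) ∈ T.obs ∧
  ((pairSnd i, pairSnd j), pairSet i, pairSet j) ∈ T.obs

/-- Both off-diagonal choices of the block `(i, j)` are observed in that `2 × 2` subgame. -/
def OffDiagObserved (T : DataSet n) (i j : Fin (n / 2)) : Prop :=
  ((pairFst i, pairSnd j), pairSet i, pairSet j) ∈ T.obs ∧
  ((pairSnd i, pairFst j), pairSet i, pairSet j) ∈ T.obs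

/-- `T` is 2-regular: its subgames are exactly the `2 × 2` blocks of consecutive strategies, and
in each block either the diagonal pair or the off-diagonal pair is observed, but not both. -/
def TwoRegular (T : DataSet n) : Prop :=
  (∀ I J : Finset (Fin n),
    T.HasSubgame I J ↔ ∃ i j : Fin (n / 2), I = pairSet i ∧ J = pairSet j) ∧
  (∀ i j : Fin (n / 2), Xor (T.DiagObserved i j) (T.OffDiagObserved i j))

/-- `S` is the sign-pattern matrix of `T`: `+1` where the diagonal pair is observed and `-1`
where the off-diagonal pair is observed. -/
def HasSignPattern (T : DataSet n) (S : Matrix (Fin (n / 2)) (Fin (n / 2)) ℤ) : Prop :=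
  ∀ i j : Fin (n / 2), (S i j = 1 ∧ T.DiagObserved i j) ∨ (S i j = -1 ∧ T.OffDiagObserved i j)

/-- The sign pattern of `T` is the Sylvester-Hadamard one: it is the leading principal submatrix
of order `n / 2` of every Sylvester-Hadamard matrix of order at least `n / 2` (so it is the
Sylvester-Hadamard matrix of order `n / 2` itself when `n / 2` is a power of two). -/
def HasSylvesterPattern (T : DataSet n) : Prop :=
  ∀ (k : ℕ) (h : n / 2 ≤ 2 ^ k),
    T.HasSignPattern ((sylvesterHadamard k).submatrix (Fin.castLE h) (Fin.castLE h))

/-- The data set obtained from `T` by replacing, in each block, the observed diagonal or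
off-diagonal pair by the corresponding three observations. -/
def splitPairs (T : DataSet n) : DataSet n where
  obs := {o | ∃ i j : Fin (n / 2),
    (T.DiagObserved i j ∧ o ∈ diagTriple i j) ∨ (T.OffDiagObserved i j ∧ o ∈ offDiagTriple i j)}
  mem_rows := by
    rintro i j I J ⟨a, b, ⟨-, h⟩ | ⟨-, h⟩⟩ <;>
    simp only [diagTriple, offDiagTriple, Set.mem_insert_iff, Set.mem_singleton_iff,
      Prod.mk.injEq] at h <;>
    rcases h with ⟨⟨rfl, rfl⟩, rfl, rfl⟩ | ⟨⟨rfl, rfl⟩, rfl, rfl⟩ | ⟨⟨rfl, rfl⟩, rfl, rfl⟩ <;>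
    simp [pairSet]
  mem_cols := by
    rintro i j I J ⟨a, b, ⟨-, h⟩ | ⟨-, h⟩⟩ <;>
    simp only [diagTriple, offDiagTriple, Set.mem_insert_iff, Set.mem_singleton_iff,
      Prod.mk.injEq] at h <;>
    rcases h with ⟨⟨rfl, rfl⟩, rfl, rfl⟩ | ⟨⟨rfl, rfl⟩, rfl, rfl⟩ | ⟨⟨rfl, rfl⟩, rfl, rfl⟩ <;>
    simp [pairSet]

/-- Every bimatrix game `(A, B)` that rationalizes `T` has rank at least `r`, where the rank of a
game is the rank of `A + B`. -/
def RankAtLeast (T : DataSet n) (r : ℝ) : Prop :=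
  ∀ A B : Matrix (Fin n) (Fin n) ℝ, T.RationalizedBy A B → r ≤ ((A + B).rank : ℝ)

end DataSet

/-!
The data set is the 2-regular one whose sign pattern is the leading part of a Sylvester–Hadamard
matrix. Write `M = A + B` and let `D i j` be the alternating sum of the four entries of `M` in the
block `(R_i, R_j)`. Adding up the four strict equilibrium inequalities of a block shows that
`D i j` is positive when the diagonal pair is observed and negative when the off-diagonal pair is
(`DiagObserved.blockSum_pos`, `OffDiagObserved.blockSum_neg`); the three observations that replace
a pair yield exactly these four inequalities, so one argument serves both data sets. Factoring `M`
through `ℝ^d`, with `d` its rank, writes `D i j = x i ⬝ᵥ y j` with `x i, y j ∈ ℝ^d`. The lower bound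
on `d` is therefore a lower bound on the sign rank of a Hadamard matrix of order `N`, where `N` is
the largest power of two with `N ≤ n / 2`. Forster's theorem gives `N ≤ d ^ 2`
(`card_le_sq_of_hadamard_sign_realization`), whence `n ≤ 4 N ≤ (2 d) ^ 2` and `c = 1 / 2` works.

Forster's theorem is proved as follows. As the sign conditions are strict, the `x i` may be assumed
to be in general position (`exists_inGeneralPosition_add_smul`). If `d < N`, the scale-invariant
function `A ↦ (det A) ^ (2 N) / ∏ ‖A x_i‖ ^ (2 d)` then attains its maximum over the invertible
matrices (`exists_isotropyFunctional_max`), and comparing the maximizer `A` with its perturbations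
`(1 + s v vᵀ) A` as `s → 0+` shows that the normalized vectors `u i = A x_i / ‖A x_i‖` satisfy
`∑ i, (u i) (u i)ᵀ ≥ (N / d) • 1` (`exists_radial_isotropic`). With `w j` the normalizations of
`A⁻ᵀ y_j`, which leave the signs unchanged, this gives
`∑ H i j (u i ⬝ w j) = ∑ |u i ⬝ w j| ≥ ∑ (u i ⬝ w j) ^ 2 ≥ N ^ 2 / d`, while orthogonality of `H`
bounds the left side by `N √N` (`card_le_sq_of_isotropic`).
-/

section

open Matrix Finset Filter Topology
open scoped Matrix.Norms.Elementwise

/-! ### General position -/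

section GeneralPosition

/-- The rows of `X`, viewed as vectors in `ℝ^d`, are in general position: any `d` of them are
linearly independent. -/
def InGeneralPosition {ι : Type*} {d : ℕ} (X : Matrix ι (Fin d) ℝ) : Prop :=
  ∀ s : Fin d → ι, Function.Injective s → (X.submatrix s id).det ≠ 0

variable {ι : Type*} [Fintype ι] {d : ℕ}

/-- Adding small multiples of points on the moment curve brings the rows of a matrix into general
position: each minor is a polynomial in `ε` whose leading coefficient is a Vandermonde
determinant. -/
theorem exists_inGeneralPosition_add_smul (X : Matrix ι (Fin d) ℝ) :
    ∃ V : Matrix ι (Fin d) ℝ, ∀ᶠ ε : ℝ in 𝓝[≠] 0, InGeneralPosition (X + ε • V) := by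
  classical
  let a : ι → ℝ := fun i => ((Fintype.equivFin ι i : ℕ) : ℝ)
  have ha : Function.Injective a := fun i j h =>
    (Fintype.equivFin ι).injective (Fin.ext (Nat.cast_injective h))
  refine ⟨Matrix.of fun i k => a i ^ (k : ℕ), ?_⟩
  set V : Matrix ι (Fin d) ℝ := Matrix.of fun i k => a i ^ (k : ℕ) with hV
  unfold InGeneralPosition
  rw [Filter.eventually_all]
  intro s
  by_cases hs : Function.Injective s
  swap
  · exact Filter.Eventually.of_forall fun _ h => absurd h hs
  let p : Polynomial ℝ := det ((Polynomial.X : Polynomial ℝ) •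
    (V.submatrix s id).map Polynomial.C + (X.submatrix s id).map Polynomial.C)
  have hp : p ≠ 0 := by
    intro h0
    have h1 : p.coeff (Fintype.card (Fin d)) = (V.submatrix s id).det :=
      Polynomial.coeff_det_X_add_C_card _ _
    have h2 : V.submatrix s id = vandermonde (a ∘ s) := by
      ext i j; simp [hV, vandermonde]
    rw [h0, h2, Polynomial.coeff_zero] at h1
    exact (det_vandermonde_ne_zero_iff.2 (ha.comp hs)) h1.symm
  have heval : ∀ ε : ℝ, p.eval ε = ((X + ε • V).submatrix s id).det := by
    intro ε
    have := RingHom.map_det (Polynomial.evalRingHom ε) ((Polynomial.X : Polynomial ℝ) •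
      (V.submatrix s id).map Polynomial.C + (X.submatrix s id).map Polynomial.C)
    rw [Polynomial.coe_evalRingHom] at this
    rw [this]
    congr 1
    ext i j
    simp [add_comm, mul_comm ε]
  have hfin : {ε : ℝ | p.eval ε = 0}.Finite := by
    refine (p.roots.toFinset.finite_toSet).subset fun ε hε => ?_
    simp only [Finset.mem_coe, Multiset.mem_toFinset, Polynomial.mem_roots hp]
    exact hε
  have hmem : ({ε : ℝ | p.eval ε = 0} \ {0})ᶜ ∈ 𝓝 (0 : ℝ) :=
    (hfin.subset Set.sdiff_subset).isClosed.isOpen_compl.mem_nhds (by simp)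
  filter_upwards [mem_nhdsWithin_of_mem_nhds hmem, self_mem_nhdsWithin] with ε h1 h2 _
  rw [← heval]
  intro h3
  exact h1 ⟨h3, h2⟩

end GeneralPosition

/-! ### Lengths of linear images and their determinant bound -/

section Extremal

/-- The squared Euclidean length of the image under `A` of the `i`-th row of `X`. -/
def sqLength {ι : Type*} {d : ℕ} (X : Matrix ι (Fin d) ℝ) (A : Matrix (Fin d) (Fin d) ℝ)
    (i : ι) : ℝ :=
  (A *ᵥ X i) ⬝ᵥ (A *ᵥ X i)

theorem dotProduct_self_nonneg_real {κ : Type*} [Fintype κ] (v : κ → ℝ) : 0 ≤ v ⬝ᵥ v :=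
  Finset.sum_nonneg fun _ _ => mul_self_nonneg _

variable {ι : Type*} {d : ℕ}

theorem sqLength_nonneg (X : Matrix ι (Fin d) ℝ) (A : Matrix (Fin d) (Fin d) ℝ) (i : ι) :
    0 ≤ sqLength X A i := dotProduct_self_nonneg_real _

theorem continuous_sqLength (X : Matrix ι (Fin d) ℝ) (i : ι) :
    Continuous fun A => sqLength X A i := by
  unfold sqLength
  fun_prop

theorem sqLength_smul (X : Matrix ι (Fin d) ℝ) (A : Matrix (Fin d) (Fin d) ℝ) (c : ℝ) (i : ι) :
    sqLength X (c • A) i = c ^ 2 * sqLength X A i := by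
  simp only [sqLength, smul_mulVec, smul_dotProduct, dotProduct_smul, smul_eq_mul]
  ring

/-- A form of Hadamard's inequality for determinants, with the crude constant that the Leibniz
formula gives. -/
theorem det_sq_le_factorial_sq_mul_prod (B : Matrix (Fin d) (Fin d) ℝ) :
    B.det ^ 2 ≤ (d.factorial : ℝ) ^ 2 * ∏ k, (B k ⬝ᵥ B k) := by
  have hentry : ∀ i j, |B i j| ≤ √(B i ⬝ᵥ B i) := by
    intro i j
    apply Real.abs_le_sqrt
    rw [sq]
    exact Finset.single_le_sum (f := fun j => B i j * B i j)
      (fun _ _ => mul_self_nonneg _) (Finset.mem_univ j)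
  have hdet : |B.det| ≤ d.factorial * ∏ k, √(B k ⬝ᵥ B k) := by
    rw [Matrix.det_apply]
    refine (Finset.abs_sum_le_sum_abs _ _).trans ?_
    have : ∀ σ : Equiv.Perm (Fin d), |Equiv.Perm.sign σ • ∏ i, B (σ i) i|
        ≤ ∏ k, √(B k ⬝ᵥ B k) := by
      intro σ
      rw [← Equiv.prod_comp σ (fun k => √(B k ⬝ᵥ B k))]
      have h1 : |Equiv.Perm.sign σ • ∏ i, B (σ i) i| = ∏ i, |B (σ i) i| := by
        rcases Int.units_eq_one_or (Equiv.Perm.sign σ) with h | h <;>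
          simp [h, Finset.abs_prod]
      rw [h1]
      exact Finset.prod_le_prod (fun _ _ => abs_nonneg _) fun i _ => hentry _ _
    refine (Finset.sum_le_sum fun σ _ => this σ).trans ?_
    simp [Finset.card_univ, Fintype.card_perm]
  rw [← sq_abs]
  refine (pow_le_pow_left₀ (abs_nonneg _) hdet 2).trans (le_of_eq ?_)
  rw [mul_pow, ← Finset.prod_pow]
  congr 1
  exact Finset.prod_congr rfl fun k _ => Real.sq_sqrt (dotProduct_self_nonneg_real _)

theorem submatrix_mul_transpose_apply (X : Matrix ι (Fin d) ℝ) (A : Matrix (Fin d) (Fin d) ℝ)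
    (s : Fin d → ι) (k : Fin d) : (X.submatrix s id * Aᵀ) k = A *ᵥ X (s k) := by
  ext l
  simp [Matrix.mul_apply, mulVec, dotProduct, mul_comm]

/-- For rows in general position, `det A ^ 2` is controlled by the product of all the
`sqLength`s, uniformly over the unit sphere: at most `d - 1` rows can be sent near zero. -/
theorem exists_det_sq_le_mul_prod_sqLength [Fintype ι] {X : Matrix ι (Fin d) ℝ}
    (hX : InGeneralPosition X) (hd : d ≤ Fintype.card ι) :
    ∃ C : ℝ, 0 ≤ C ∧ ∀ A : Matrix (Fin d) (Fin d) ℝ, ‖A‖ = 1 →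
      A.det ^ 2 ≤ C * ∏ i, sqLength X A i := by
  classical
  -- `h` is positive on the sphere because some `d` rows include all those that `A` annihilates;
  -- its summand at `s` is what the bound `det (X_s Aᵀ) ^ 2 ≤ C ∏ ‖A x_(s k)‖ ^ 2` lacks in factors
  let h : Matrix (Fin d) (Fin d) ℝ → ℝ := fun A => ∑ s : Fin d ↪ ι,
    (X.submatrix s id).det ^ 2 * ∏ i ∈ (univ.map s)ᶜ, sqLength X A i
  have hcont : Continuous h :=
    continuous_finsetSum _ fun s _ => continuous_const.mul
      (continuous_finsetProd _ fun i _ => continuous_sqLength X i)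
  have hterm : ∀ A (s : Fin d ↪ ι), 0 ≤ (X.submatrix s id).det ^ 2 *
      ∏ i ∈ (univ.map s)ᶜ, sqLength X A i := fun A s =>
    mul_nonneg (sq_nonneg _) (Finset.prod_nonneg fun i _ => sqLength_nonneg _ _ _)
  have hpos : ∀ A : Matrix (Fin d) (Fin d) ℝ, ‖A‖ = 1 → 0 < h A := by
    intro A hA
    let Z : Finset ι := univ.filter fun i => sqLength X A i = 0
    have hZ : Z.card ≤ d := by
      by_contra hcon
      push Not at hcon
      obtain ⟨t, htZ, ht⟩ := Finset.exists_subset_card_eq hcon.le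
      let s : Fin d ↪ ι := (t.equivFinOfCardEq ht).symm.toEmbedding.trans
        (Function.Embedding.subtype _)
      have hs : ∀ k, s k ∈ Z := fun k => htZ ((t.equivFinOfCardEq ht).symm k).2
      have h0 : X.submatrix s id * Aᵀ = 0 := by
        ext k l
        rw [submatrix_mul_transpose_apply]
        have h1 : (A *ᵥ X (s k)) ⬝ᵥ (A *ᵥ X (s k)) = 0 := (Finset.mem_filter.1 (hs k)).2
        rw [dotProduct_self_eq_zero] at h1
        rw [h1]; rfl
      have hu : IsUnit (X.submatrix s id) :=
        (Matrix.isUnit_iff_isUnit_det _).2 (isUnit_iff_ne_zero.2 (hX s s.injective))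
      have hA0 : Aᵀ = 0 := hu.mul_right_eq_zero.1 h0
      rw [Matrix.transpose_eq_zero] at hA0
      rw [hA0, norm_zero] at hA
      exact zero_ne_one hA
    obtain ⟨t, hZt, -, ht⟩ := Finset.exists_subsuperset_card_eq (Finset.subset_univ Z) hZ
      (by simpa using hd)
    let s : Fin d ↪ ι := (t.equivFinOfCardEq ht).symm.toEmbedding.trans
      (Function.Embedding.subtype _)
    have hs : univ.map s = t := by
      ext i
      simp only [Finset.mem_map, Finset.mem_univ, true_and]
      constructor
      · rintro ⟨k, rfl⟩
        exact ((t.equivFinOfCardEq ht).symm k).2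
      · intro hi
        exact ⟨t.equivFinOfCardEq ht ⟨i, hi⟩, by simp [s]⟩
    refine Finset.sum_pos' (fun s _ => hterm A s) ⟨s, Finset.mem_univ _, ?_⟩
    refine mul_pos (sq_pos_of_ne_zero (hX s s.injective)) (Finset.prod_pos fun i hi => ?_)
    refine lt_of_le_of_ne (sqLength_nonneg _ _ _) fun h0 => ?_
    rw [hs, Finset.mem_compl] at hi
    exact hi (hZt (Finset.mem_filter.2 ⟨Finset.mem_univ _, h0.symm⟩))
  have hmain : ∀ A : Matrix (Fin d) (Fin d) ℝ, A.det ^ 2 * h A ≤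
      (Fintype.card (Fin d ↪ ι) * (d.factorial : ℝ) ^ 2) * ∏ i, sqLength X A i := by
    intro A
    have : ∀ s : Fin d ↪ ι, A.det ^ 2 * ((X.submatrix s id).det ^ 2 *
        ∏ i ∈ (univ.map s)ᶜ, sqLength X A i) ≤
        (d.factorial : ℝ) ^ 2 * ∏ i, sqLength X A i := by
      intro s
      have h1 := det_sq_le_factorial_sq_mul_prod (X.submatrix s id * Aᵀ)
      rw [det_mul, det_transpose, mul_pow] at h1
      simp only [submatrix_mul_transpose_apply] at h1
      have h2 : ∏ i, sqLength X A i =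
          (∏ k, (A *ᵥ X (s k)) ⬝ᵥ (A *ᵥ X (s k))) * ∏ i ∈ (univ.map s)ᶜ, sqLength X A i := by
        rw [← Finset.prod_mul_prod_compl (univ.map s), Finset.prod_map]
        rfl
      rw [h2, ← mul_assoc, ← mul_assoc, mul_comm (A.det ^ 2)]
      exact mul_le_mul_of_nonneg_right h1 (Finset.prod_nonneg fun i _ => sqLength_nonneg _ _ _)
    rw [Finset.mul_sum]
    refine (Finset.sum_le_sum fun s _ => this s).trans (le_of_eq ?_)
    simp [mul_assoc]
  have hK : IsCompact (Metric.sphere (0 : Matrix (Fin d) (Fin d) ℝ) 1) := isCompact_sphere _ _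
  rcases (Metric.sphere (0 : Matrix (Fin d) (Fin d) ℝ) 1).eq_empty_or_nonempty with hE | hE
  · refine ⟨0, le_rfl, fun A hA => ?_⟩
    have : A ∈ Metric.sphere (0 : Matrix (Fin d) (Fin d) ℝ) 1 := by simpa using hA
    rw [hE] at this
    exact this.elim
  · obtain ⟨A₀, hA₀, hmin⟩ := hK.exists_isMinOn hE hcont.continuousOn
    have hA₀' : 0 < h A₀ := hpos A₀ (by simpa using hA₀)
    refine ⟨(Fintype.card (Fin d ↪ ι) * (d.factorial : ℝ) ^ 2) / h A₀, by positivity,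
      fun A hA => ?_⟩
    have h1 : h A₀ ≤ h A := hmin (by simpa using hA)
    rw [div_mul_eq_mul_div, le_div_iff₀ hA₀']
    exact (mul_le_mul_of_nonneg_left h1 (sq_nonneg _)).trans (hmain A)

end Extremal

/-! ### Radial isotropic position and Forster's bound -/

section Forster

variable {ι : Type*} {d : ℕ}

theorem sqLength_one_add_smul_vecMulVec_mul (X : Matrix ι (Fin d) ℝ)
    (A : Matrix (Fin d) (Fin d) ℝ) (v : Fin d → ℝ) (s : ℝ) (i : ι) :
    sqLength X ((1 + s • vecMulVec v v) * A) i =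
      sqLength X A i + (2 * s + s ^ 2 * (v ⬝ᵥ v)) * (v ⬝ᵥ (A *ᵥ X i)) ^ 2 := by
  have : ((1 + s • vecMulVec v v) * A) *ᵥ X i =
      A *ᵥ X i + (s * (v ⬝ᵥ (A *ᵥ X i))) • v := by
    rw [← mulVec_mulVec, add_mulVec, one_mulVec, smul_mulVec, vecMulVec_mulVec]
    ext k
    simp [mul_assoc]
  unfold sqLength
  rw [this]
  simp only [add_dotProduct, dotProduct_add, smul_dotProduct, dotProduct_smul, smul_eq_mul]
  rw [dotProduct_comm (A *ᵥ X i) v]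
  ring

theorem det_one_add_smul_vecMulVec (v : Fin d → ℝ) (s : ℝ) :
    (1 + s • vecMulVec v v).det = 1 + s * (v ⬝ᵥ v) := by
  rw [← smul_vecMulVec, vecMulVec_eq Unit, det_one_add_replicateCol_mul_replicateRow,
    dotProduct_smul, smul_eq_mul]

variable [Fintype ι]

/-- The scale-invariant functional `det A ^ (2 N) / ∏ i, ‖A x_i‖ ^ (2 d)`, whose maximizer puts the
rows `x_i` of `X` into radial isotropic position. It is `0` at every singular `A` as soon as there
is a row. -/
noncomputable def isotropyFunctional (X : Matrix ι (Fin d) ℝ) (A : Matrix (Fin d) (Fin d) ℝ) : ℝ :=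
  (A.det ^ 2) ^ Fintype.card ι / (∏ i, sqLength X A i) ^ d

theorem isotropyFunctional_smul (X : Matrix ι (Fin d) ℝ) (A : Matrix (Fin d) (Fin d) ℝ) {c : ℝ}
    (hc : c ≠ 0) : isotropyFunctional X (c • A) = isotropyFunctional X A := by
  unfold isotropyFunctional
  simp only [sqLength_smul, det_smul, Finset.prod_mul_distrib, Finset.prod_const,
    Fintype.card_fin, Finset.card_univ]
  have : ((c ^ d * A.det) ^ 2) ^ Fintype.card ι
      = (c ^ 2) ^ (d * Fintype.card ι) * (A.det ^ 2) ^ Fintype.card ι := by ring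
  rw [this, mul_pow, ← pow_mul (c ^ 2) (Fintype.card ι) d, mul_comm (Fintype.card ι) d]
  exact mul_div_mul_left _ _ (by positivity)

/-- If there are more rows than dimensions, the functional attains its maximum: it extends
continuously by `0` to the singular matrices of the unit sphere. -/
theorem exists_isotropyFunctional_max {X : Matrix ι (Fin d) ℝ} (hX : InGeneralPosition X)
    (hd0 : 0 < d) (hd : d < Fintype.card ι) :
    ∃ A : Matrix (Fin d) (Fin d) ℝ, A.det ≠ 0 ∧ (∀ i, 0 < sqLength X A i) ∧
      ∀ B : Matrix (Fin d) (Fin d) ℝ, B.det ≠ 0 →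
        isotropyFunctional X B ≤ isotropyFunctional X A := by
  obtain ⟨C, hC0, hC⟩ := exists_det_sq_le_mul_prod_sqLength hX hd.le
  have hprod0 : ∀ A, 0 ≤ ∏ i, sqLength X A i := fun A =>
    Finset.prod_nonneg fun i _ => sqLength_nonneg _ _ _
  have hprodpos : ∀ A : Matrix (Fin d) (Fin d) ℝ, ‖A‖ = 1 → A.det ≠ 0 →
      0 < ∏ i, sqLength X A i := by
    intro A hA hdet
    refine lt_of_le_of_ne (hprod0 A) fun h0 => ?_
    have := hC A hA
    rw [← h0, mul_zero] at this
    exact absurd this (not_le.2 (by positivity))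
  have hbound : ∀ A : Matrix (Fin d) (Fin d) ℝ, ‖A‖ = 1 → isotropyFunctional X A ≤
      C ^ d * (A.det ^ 2) ^ (Fintype.card ι - d) := by
    intro A hA
    refine div_le_of_le_mul₀ (pow_nonneg (hprod0 A) _) (by positivity) ?_
    calc (A.det ^ 2) ^ Fintype.card ι
        = (A.det ^ 2) ^ (Fintype.card ι - d) * (A.det ^ 2) ^ d := by
          rw [← pow_add, Nat.sub_add_cancel hd.le]
      _ ≤ (A.det ^ 2) ^ (Fintype.card ι - d) * (C * ∏ i, sqLength X A i) ^ d := by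
          gcongr
          exact hC A hA
      _ = _ := by rw [mul_pow]; ring
  have hcont : ContinuousOn (isotropyFunctional X)
      (Metric.sphere (0 : Matrix (Fin d) (Fin d) ℝ) 1) := by
    intro A hA
    have hA1 : ‖A‖ = 1 := by simpa using hA
    have hcdet : Continuous fun B : Matrix (Fin d) (Fin d) ℝ => B.det :=
      Continuous.matrix_det continuous_id
    by_cases hdet : A.det = 0
    -- here the denominator may vanish, and `hbound` squeezes the functional towards `0`
    · have h0 : isotropyFunctional X A = 0 := by
        unfold isotropyFunctional
        rw [hdet, zero_pow two_ne_zero, zero_pow (by omega), zero_div]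
      unfold ContinuousWithinAt
      rw [h0]
      have hlim : Tendsto (fun B : Matrix (Fin d) (Fin d) ℝ =>
          C ^ d * (B.det ^ 2) ^ (Fintype.card ι - d))
          (𝓝[Metric.sphere 0 1] A) (𝓝 0) := by
        have hc : Continuous fun B : Matrix (Fin d) (Fin d) ℝ =>
            C ^ d * (B.det ^ 2) ^ (Fintype.card ι - d) :=
          continuous_const.mul ((hcdet.pow 2).pow _)
        have := hc.continuousWithinAt (s := Metric.sphere 0 1) (x := A)
        simp only [ContinuousWithinAt] at this
        rwa [hdet, zero_pow two_ne_zero, zero_pow (by omega), mul_zero] at this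
      refine tendsto_of_tendsto_of_tendsto_of_le_of_le' tendsto_const_nhds hlim ?_ ?_
      · exact Filter.Eventually.of_forall fun B =>
          div_nonneg (by positivity) (pow_nonneg (hprod0 B) _)
      · filter_upwards [self_mem_nhdsWithin] with B hB
        exact hbound B (by simpa using hB)
    · refine ContinuousAt.continuousWithinAt ?_
      refine ContinuousAt.div ((hcdet.pow 2).pow _).continuousAt ?_
        (pow_pos (hprodpos A hA1 hdet) _).ne'
      exact ((continuous_finsetProd _ fun i _ => continuous_sqLength X i).pow _).continuousAt
  have : Nonempty (Fin d) := ⟨⟨0, hd0⟩⟩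
  have hscale : ∀ B : Matrix (Fin d) (Fin d) ℝ, B.det ≠ 0 → B ≠ 0 ∧
      ‖(‖B‖⁻¹ • B)‖ = 1 ∧ (‖B‖⁻¹ • B).det ≠ 0 ∧
      isotropyFunctional X (‖B‖⁻¹ • B) = isotropyFunctional X B := by
    intro B hB
    have hB0 : B ≠ 0 := by
      rintro rfl
      exact hB det_zero
    have hn : ‖B‖ ≠ 0 := norm_ne_zero_iff.2 hB0
    refine ⟨hB0, ?_, ?_, isotropyFunctional_smul X B (inv_ne_zero hn)⟩
    · rw [norm_smul, norm_inv, norm_norm, inv_mul_cancel₀ hn]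
    · rw [det_smul]
      exact mul_ne_zero (pow_ne_zero _ (inv_ne_zero hn)) hB
  obtain ⟨-, h1n, h1d, -⟩ := hscale 1 (by simp)
  obtain ⟨A, hA, hmax⟩ := (isCompact_sphere (0 : Matrix (Fin d) (Fin d) ℝ) 1).exists_isMaxOn
    ⟨‖(1 : Matrix (Fin d) (Fin d) ℝ)‖⁻¹ • 1, by simp⟩ hcont
  have hA1 : ‖A‖ = 1 := by simpa using hA
  have hAdet : A.det ≠ 0 := by
    intro h0
    have h2 : isotropyFunctional X (‖(1 : Matrix (Fin d) (Fin d) ℝ)‖⁻¹ • 1) ≤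
      isotropyFunctional X A := hmax (by simp)
    have h3 : isotropyFunctional X A = 0 := by
      unfold isotropyFunctional
      rw [h0, zero_pow two_ne_zero, zero_pow (by omega), zero_div]
    rw [h3] at h2
    exact absurd h2 (not_le.2 (div_pos (by positivity) (pow_pos (hprodpos _ h1n h1d) _)))
  refine ⟨A, hAdet, fun i => lt_of_le_of_ne (sqLength_nonneg _ _ _) fun h0 => ?_, fun B hB => ?_⟩
  · exact (hprodpos A hA1 hAdet).ne' (Finset.prod_eq_zero (Finset.mem_univ i) h0.symm)
  · obtain ⟨-, hn, -, he⟩ := hscale B hB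
    rw [← he]
    exact hmax (by simpa using hn)

/-- Radial isotropic position: vectors in general position have an invertible linear image whose
normalizations `u i` satisfy `∑ i, (u i) (u i)ᵀ ≥ (N / d) • 1`, with `N` the number of vectors
(equality then follows by taking traces). -/
theorem exists_radial_isotropic {X : Matrix ι (Fin d) ℝ} (hX : InGeneralPosition X)
    (hd0 : 0 < d) (hd : d < Fintype.card ι) :
    ∃ A : Matrix (Fin d) (Fin d) ℝ, A.det ≠ 0 ∧ (∀ i, 0 < sqLength X A i) ∧
      ∀ v : Fin d → ℝ, Fintype.card ι * (v ⬝ᵥ v) ≤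
        d * ∑ i, (v ⬝ᵥ (A *ᵥ X i)) ^ 2 / sqLength X A i := by
  obtain ⟨A, hdet, hq, hmax⟩ := exists_isotropyFunctional_max hX hd0 hd
  refine ⟨A, hdet, hq, fun v => ?_⟩
  set W := v ⬝ᵥ v with hW
  set Q := ∑ i, (v ⬝ᵥ (A *ᵥ X i)) ^ 2 / sqLength X A i with hQ
  have hW0 : 0 ≤ W := dotProduct_self_nonneg_real v
  have hP : 0 < ∏ i, sqLength X A i := Finset.prod_pos fun i _ => hq i
  -- comparison with the perturbation `(1 + s v vᵀ) A` of the maximizer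
  have key : ∀ s : ℝ, 0 < s → 2 * Fintype.card ι * W ≤ (1 + s * W) * (d * ((2 + s * W) * Q)) := by
    intro s hs
    have hsW : 0 ≤ s * W := mul_nonneg hs.le hW0
    have hpos : 0 < 1 + s * W := by linarith
    set τ := 2 * s + s ^ 2 * W with hτ
    have hτ0 : 0 ≤ τ := by positivity
    have h1 := hmax ((1 + s • vecMulVec v v) * A) (by
      rw [det_mul, det_one_add_smul_vecMulVec]
      exact mul_ne_zero hpos.ne' hdet)
    unfold isotropyFunctional at h1
    rw [det_mul, det_one_add_smul_vecMulVec, ← hW, mul_pow, mul_pow] at h1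
    simp only [sqLength_one_add_smul_vecMulVec_mul] at h1
    rw [← hW, ← hτ] at h1
    have h2 : ∏ i, (sqLength X A i + τ * (v ⬝ᵥ (A *ᵥ X i)) ^ 2) =
        (∏ i, sqLength X A i) * ∏ i, (1 + τ * ((v ⬝ᵥ (A *ᵥ X i)) ^ 2 / sqLength X A i)) := by
      rw [← Finset.prod_mul_distrib]
      refine Finset.prod_congr rfl fun i _ => ?_
      have := (hq i).ne'
      field_simp
    have hR : ∀ i, 0 ≤ (v ⬝ᵥ (A *ᵥ X i)) ^ 2 / sqLength X A i := fun i =>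
      div_nonneg (sq_nonneg _) (hq i).le
    have hRp : 0 < ∏ i, (1 + τ * ((v ⬝ᵥ (A *ᵥ X i)) ^ 2 / sqLength X A i)) :=
      Finset.prod_pos fun i _ => by have := mul_nonneg hτ0 (hR i); linarith
    rw [h2, mul_pow, div_le_div_iff₀ (by positivity) (by positivity)] at h1
    have hD : 0 < (A.det ^ 2) ^ Fintype.card ι * (∏ i, sqLength X A i) ^ d := by positivity
    have h3 : ((1 + s * W) ^ 2) ^ Fintype.card ι ≤
        (∏ i, (1 + τ * ((v ⬝ᵥ (A *ᵥ X i)) ^ 2 / sqLength X A i))) ^ d := by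
      refine le_of_mul_le_mul_right ?_ hD
      linarith
    have h4 : ∏ i, (1 + τ * ((v ⬝ᵥ (A *ᵥ X i)) ^ 2 / sqLength X A i)) ≤ Real.exp (τ * Q) := by
      rw [hQ, Finset.mul_sum, Real.exp_sum]
      refine Finset.prod_le_prod (fun i _ => ?_) fun i _ => ?_
      · have := mul_nonneg hτ0 (hR i); linarith
      · rw [add_comm]; exact Real.add_one_le_exp _
    have h5 : ((1 + s * W) ^ 2) ^ Fintype.card ι ≤ Real.exp (d * (τ * Q)) := by
      rw [Real.exp_nat_mul]
      exact h3.trans (pow_le_pow_left₀ hRp.le h4 d)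
    have h6 := Real.log_le_log (by positivity) h5
    rw [Real.log_exp, Real.log_pow, Real.log_pow] at h6
    have h7 := Real.one_sub_inv_le_log_of_pos hpos
    have h8 : s * W ≤ (1 + s * W) * Real.log (1 + s * W) := by
      have := mul_le_mul_of_nonneg_left h7 hpos.le
      rw [mul_sub, mul_inv_cancel₀ hpos.ne'] at this
      linarith
    have h9 : s * (2 * Fintype.card ι * W) ≤
        s * ((1 + s * W) * (d * ((2 + s * W) * Q))) := by
      calc s * (2 * Fintype.card ι * W) = 2 * Fintype.card ι * (s * W) := by ring
        _ ≤ 2 * Fintype.card ι * ((1 + s * W) * Real.log (1 + s * W)) := by gcongr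
        _ = (1 + s * W) * (Fintype.card ι * ((2 : ℕ) * Real.log (1 + s * W))) := by
          push_cast; ring
        _ ≤ (1 + s * W) * (d * (τ * Q)) := by gcongr
        _ = _ := by rw [hτ]; ring
    exact le_of_mul_le_mul_left h9 hs
  have hlim : Tendsto (fun s : ℝ => (1 + s * W) * (d * ((2 + s * W) * Q))) (𝓝[>] 0)
      (𝓝 (2 * (d * Q))) := by
    have hc : Continuous fun s : ℝ => (1 + s * W) * (d * ((2 + s * W) * Q)) := by fun_prop
    have := (hc.tendsto 0).mono_left (nhdsWithin_le_nhds (s := Set.Ioi 0))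
    convert this using 2
    ring
  have := ge_of_tendsto hlim (by
    filter_upwards [self_mem_nhdsWithin] with s hs using key s hs)
  linarith

/-- The counting step of Forster's argument. If `x` are unit vectors in radial isotropic position
and `y` unit vectors whose inner products with `x` follow the signs of the Hadamard matrix `H`,
then `∑ (x i ⬝ y j) ^ 2 ≤ ∑ |x i ⬝ y j| = ∑ H i j (x i ⬝ y j)`, and orthogonality of `H` bounds
the right-hand side. -/
theorem card_le_sq_of_isotropic {H : Matrix ι ι ℝ} [DecidableEq ι]
    (hsign : ∀ i j, H i j = 1 ∨ H i j = -1)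
    (horth : H * Hᵀ = (Fintype.card ι : ℝ) • (1 : Matrix ι ι ℝ)) {x y : ι → Fin d → ℝ}
    (hx : ∀ i, x i ⬝ᵥ x i = 1) (hy : ∀ j, y j ⬝ᵥ y j = 1)
    (hpos : ∀ i j, 0 < H i j * (x i ⬝ᵥ y j))
    (hiso : ∀ v : Fin d → ℝ, Fintype.card ι * (v ⬝ᵥ v) ≤ d * ∑ i, (v ⬝ᵥ x i) ^ 2) :
    Fintype.card ι ≤ d ^ 2 := by
  set N : ℝ := (Fintype.card ι : ℝ) with hN
  let z : ι → Fin d → ℝ := fun j => ∑ i, H i j • x i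
  set T : ℝ := ∑ j, y j ⬝ᵥ z j with hT
  have hTeq : T = ∑ j, ∑ i, H i j * (x i ⬝ᵥ y j) := by
    refine Finset.sum_congr rfl fun j _ => ?_
    rw [dotProduct_sum]
    refine Finset.sum_congr rfl fun i _ => ?_
    rw [dotProduct_smul, smul_eq_mul, dotProduct_comm]
  have hlow : N * N ≤ d * T := by
    have h1 : ∀ i j, (y j ⬝ᵥ x i) ^ 2 ≤ H i j * (x i ⬝ᵥ y j) := by
      intro i j
      have hsq : (x i - H i j • y j) ⬝ᵥ (x i - H i j • y j) =
          2 - 2 * (H i j * (x i ⬝ᵥ y j)) := by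
        simp only [sub_dotProduct, dotProduct_sub, smul_dotProduct, dotProduct_smul, smul_eq_mul,
          hx, hy, dotProduct_comm (y j) (x i)]
        rcases hsign i j with h | h <;> rw [h] <;> ring
      have h0 := dotProduct_self_nonneg_real (x i - H i j • y j)
      rw [hsq] at h0
      have hp := hpos i j
      have h2 : (y j ⬝ᵥ x i) ^ 2 = (H i j * (x i ⬝ᵥ y j)) ^ 2 := by
        rw [dotProduct_comm (y j)]
        rcases hsign i j with h | h <;> rw [h] <;> ring
      rw [h2]
      nlinarith
    have h2 : ∀ j, N ≤ d * ∑ i, H i j * (x i ⬝ᵥ y j) := by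
      intro j
      have := hiso (y j)
      rw [hy, mul_one] at this
      exact this.trans (by gcongr with i; exact h1 i j)
    calc N * N = ∑ _j : ι, N := by simp [hN]
      _ ≤ ∑ j, d * ∑ i, H i j * (x i ⬝ᵥ y j) := Finset.sum_le_sum fun j _ => h2 j
      _ = d * T := by rw [hTeq, Finset.mul_sum]
  -- orthogonality of the rows of `H` removes the cross terms
  have hzz : ∑ j, z j ⬝ᵥ z j = N * N := by
    have h1 : ∀ j, z j ⬝ᵥ z j = ∑ i, ∑ k, H i j * H k j * (x i ⬝ᵥ x k) := by
      intro j
      simp only [z, sum_dotProduct]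
      refine Finset.sum_congr rfl fun i _ => ?_
      rw [dotProduct_sum]
      refine Finset.sum_congr rfl fun k _ => ?_
      rw [smul_dotProduct, dotProduct_smul, smul_eq_mul, smul_eq_mul, mul_assoc]
    have h2 : ∀ i k, ∑ j, H i j * H k j = if i = k then N else 0 := by
      intro i k
      have := congrFun (congrFun horth i) k
      simp only [Matrix.mul_apply, transpose_apply, Matrix.smul_apply, one_apply, smul_eq_mul,
        mul_ite, mul_one, mul_zero] at this
      exact this
    calc ∑ j, z j ⬝ᵥ z j = ∑ j, ∑ i, ∑ k, H i j * H k j * (x i ⬝ᵥ x k) :=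
          Finset.sum_congr rfl fun j _ => h1 j
      _ = ∑ i, ∑ k, (∑ j, H i j * H k j) * (x i ⬝ᵥ x k) := by
          rw [Finset.sum_comm]
          refine Finset.sum_congr rfl fun i _ => ?_
          rw [Finset.sum_comm]
          simp only [Finset.sum_mul]
      _ = N * N := by simp [h2, hx, hN]
  -- Cauchy–Schwarz for `∑ y j ⬝ z j` in the form `∑ ‖d z_j - N y_j‖ ^ 2 ≥ 0`, which avoids `√N`
  have hup : 0 ≤ (d : ℝ) ^ 2 * (N * N) - 2 * d * N * T + N ^ 2 * N := by
    have h1 : 0 ≤ ∑ j, ((d : ℝ) • z j - N • y j) ⬝ᵥ ((d : ℝ) • z j - N • y j) :=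
      Finset.sum_nonneg fun j _ => dotProduct_self_nonneg_real _
    have h2 : ∀ j, ((d : ℝ) • z j - N • y j) ⬝ᵥ ((d : ℝ) • z j - N • y j) =
        (d : ℝ) ^ 2 * (z j ⬝ᵥ z j) - 2 * d * N * (y j ⬝ᵥ z j) + N ^ 2 * 1 := by
      intro j
      simp only [sub_dotProduct, dotProduct_sub, smul_dotProduct, dotProduct_smul, smul_eq_mul,
        hy, dotProduct_comm (z j) (y j)]
      ring
    simp only [h2, Finset.sum_add_distrib, Finset.sum_sub_distrib, ← Finset.mul_sum] at h1
    rw [hzz, ← hT] at h1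
    simpa [hN] using h1
  rcases Nat.eq_zero_or_pos (Fintype.card ι) with h0 | h0
  · rw [h0]; exact Nat.zero_le _
  have hNp : 0 < N := by rw [hN]; exact_mod_cast h0
  have h3 : N * N * N ≤ N * N * (d : ℝ) ^ 2 := by nlinarith
  have h4 : N ≤ (d : ℝ) ^ 2 := le_of_mul_le_mul_left h3 (by positivity)
  rw [hN] at h4
  exact_mod_cast h4

/-- Forster's bound for Hadamard matrices: a realization of the sign pattern of a Hadamard matrix
of order `N` by inner products of vectors of `ℝ^d` has `N ≤ d ^ 2`. -/
theorem card_le_sq_of_hadamard_sign_realization {H : Matrix ι ι ℝ} [DecidableEq ι]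
    (hsign : ∀ i j, H i j = 1 ∨ H i j = -1)
    (horth : H * Hᵀ = (Fintype.card ι : ℝ) • (1 : Matrix ι ι ℝ)) {x y : ι → Fin d → ℝ}
    (hpos : ∀ i j, 0 < H i j * (x i ⬝ᵥ y j)) :
    Fintype.card ι ≤ d ^ 2 := by
  rcases Nat.lt_or_ge d (Fintype.card ι) with hd | hd
  swap
  · exact hd.trans (Nat.le_self_pow two_ne_zero d)
  have : Nonempty ι := Fintype.card_pos_iff.1 (by omega)
  rcases Nat.eq_zero_or_pos d with rfl | hd0
  · obtain ⟨i⟩ := this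
    have := hpos i i
    simp [dotProduct] at this
  -- the strict sign conditions survive a small perturbation into general position
  obtain ⟨X, hX, hXpos⟩ : ∃ X : Matrix ι (Fin d) ℝ, InGeneralPosition X ∧
      ∀ i j, 0 < H i j * (X i ⬝ᵥ y j) := by
    obtain ⟨V, hV⟩ := exists_inGeneralPosition_add_smul (Matrix.of x)
    have hev : ∀ᶠ ε : ℝ in 𝓝[≠] 0, ∀ i j, 0 < H i j * ((Matrix.of x + ε • V) i ⬝ᵥ y j) := by
      refine Filter.Eventually.filter_mono nhdsWithin_le_nhds ?_
      rw [Filter.eventually_all]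
      intro i
      rw [Filter.eventually_all]
      intro j
      have hc : Continuous fun ε : ℝ => H i j * ((Matrix.of x + ε • V) i ⬝ᵥ y j) := by
        simp only [dotProduct, Matrix.add_apply, Matrix.smul_apply]
        fun_prop
      refine hc.continuousAt.eventually (lt_mem_nhds ?_)
      have h0 : Matrix.of x + (0 : ℝ) • V = Matrix.of x := by rw [zero_smul, add_zero]
      change 0 < H i j * ((Matrix.of x + (0 : ℝ) • V) i ⬝ᵥ y j)
      rw [h0]
      exact hpos i j
    obtain ⟨ε, h1, h2⟩ := (hV.and hev).exists
    exact ⟨_, h1, h2⟩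
  obtain ⟨A, hdet, hq, hiso⟩ := exists_radial_isotropic hX hd0 hd
  have hu : IsUnit A.det := isUnit_iff_ne_zero.2 hdet
  -- passing to `A x` and `A⁻ᵀ y` keeps the inner products
  let w : ι → Fin d → ℝ := fun j => (A⁻¹)ᵀ *ᵥ y j
  have hdot : ∀ i j, (A *ᵥ X i) ⬝ᵥ w j = X i ⬝ᵥ y j := by
    intro i j
    change (A *ᵥ X i) ⬝ᵥ ((A⁻¹)ᵀ *ᵥ y j) = X i ⬝ᵥ y j
    rw [dotProduct_comm, mulVec_transpose, ← dotProduct_mulVec, mulVec_mulVec,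
      nonsing_inv_mul A hu, one_mulVec, dotProduct_comm]
  have hw : ∀ j, 0 < w j ⬝ᵥ w j := by
    intro j
    refine lt_of_le_of_ne (dotProduct_self_nonneg_real _) fun h0 => ?_
    have h1 : w j = 0 := dotProduct_self_eq_zero.1 h0.symm
    have := hXpos j j
    rw [← hdot, h1, dotProduct_zero, mul_zero] at this
    exact lt_irrefl _ this
  have hnorm : ∀ a : ℝ, 0 < a → (√a)⁻¹ * ((√a)⁻¹ * a) = 1 := by
    intro a ha
    have := Real.mul_self_sqrt ha.le
    have h2 := Real.sqrt_pos.2 ha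
    field_simp
    nlinarith
  refine card_le_sq_of_isotropic (H := H) hsign horth
    (x := fun i => (√(sqLength X A i))⁻¹ • (A *ᵥ X i))
    (y := fun j => (√(w j ⬝ᵥ w j))⁻¹ • w j) (fun i => ?_) (fun j => ?_) (fun i j => ?_)
    (fun v => ?_)
  · rw [smul_dotProduct, dotProduct_smul, smul_eq_mul, smul_eq_mul]
    exact hnorm _ (hq i)
  · rw [smul_dotProduct, dotProduct_smul, smul_eq_mul, smul_eq_mul]
    exact hnorm _ (hw j)
  · rw [smul_dotProduct, dotProduct_smul, smul_eq_mul, smul_eq_mul, hdot]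
    have h1 := Real.sqrt_pos.2 (hq i)
    have h2 := Real.sqrt_pos.2 (hw j)
    have h3 := hXpos i j
    have : H i j * ((√(sqLength X A i))⁻¹ * ((√(w j ⬝ᵥ w j))⁻¹ * (X i ⬝ᵥ y j))) =
        (√(sqLength X A i))⁻¹ * (√(w j ⬝ᵥ w j))⁻¹ * (H i j * (X i ⬝ᵥ y j)) := by ring
    rw [this]
    positivity
  · refine (hiso v).trans (le_of_eq ?_)
    congr 1
    refine Finset.sum_congr rfl fun i _ => ?_
    rw [dotProduct_smul, smul_eq_mul, mul_pow, inv_pow, Real.sq_sqrt (hq i).le]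
    rw [div_eq_inv_mul]

end Forster

/-! ### Sylvester–Hadamard matrices -/

section Sylvester

theorem sylvesterHadamard_eq_one_or_neg_one (k : ℕ) (i j : Fin (2 ^ k)) :
    sylvesterHadamard k i j = 1 ∨ sylvesterHadamard k i j = -1 := by
  induction k with
  | zero => exact Or.inl rfl
  | succ k ih =>
    simp only [sylvesterHadamard, reindex_apply, submatrix_apply]
    generalize (finSumFinEquiv.trans (finCongr _) : Fin (2 ^ k) ⊕ Fin (2 ^ k) ≃ _).symm i = a
    generalize (finSumFinEquiv.trans (finCongr _) : Fin (2 ^ k) ⊕ Fin (2 ^ k) ≃ _).symm j = b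
    rcases a with a | a <;> rcases b with b | b <;> simp [ih, neg_eq_iff_eq_neg, (ih a b).symm]

theorem sylvesterHadamard_mul_transpose (k : ℕ) :
    sylvesterHadamard k * (sylvesterHadamard k)ᵀ =
      (2 ^ k : ℤ) • (1 : Matrix (Fin (2 ^ k)) (Fin (2 ^ k)) ℤ) := by
  induction k with
  | zero => decide
  | succ k ih =>
    simp only [sylvesterHadamard, reindex_apply, transpose_submatrix]
    rw [submatrix_mul_equiv, fromBlocks_transpose, fromBlocks_multiply]
    simp only [transpose_neg, Matrix.mul_neg, Matrix.neg_mul, neg_neg, ih, add_neg_cancel]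
    rw [← two_smul ℤ ((2 ^ k : ℤ) • (1 : Matrix (Fin (2 ^ k)) (Fin (2 ^ k)) ℤ)), smul_smul,
      ← pow_succ']
    have : fromBlocks ((2 ^ (k + 1) : ℤ) • (1 : Matrix (Fin (2 ^ k)) (Fin (2 ^ k)) ℤ)) 0 0
        ((2 ^ (k + 1) : ℤ) • (1 : Matrix (Fin (2 ^ k)) (Fin (2 ^ k)) ℤ)) =
        (2 ^ (k + 1) : ℤ) • 1 := by
      rw [← fromBlocks_one, fromBlocks_smul, smul_zero]
    rw [this, submatrix_smul, Pi.smul_apply, Pi.smul_apply, submatrix_one_equiv]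

/-- The Sylvester–Hadamard matrices are leading principal submatrices of one another. -/
theorem sylvesterHadamard_apply_eq_of_val_eq {k l : ℕ} {i j : Fin (2 ^ k)} {i' j' : Fin (2 ^ l)}
    (hi : i.val = i'.val) (hj : j.val = j'.val) :
    sylvesterHadamard k i j = sylvesterHadamard l i' j' := by
  wlog hkl : k ≤ l generalizing k l
  · exact (this hi.symm hj.symm (le_of_not_ge hkl)).symm
  induction l, hkl using Nat.le_induction with
  | base => rw [Fin.ext hi, Fin.ext hj]
  | succ l hkl ih =>
    have hpow : 2 ^ k ≤ 2 ^ l := Nat.pow_le_pow_right two_pos hkl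
    have hi' : i'.val < 2 ^ l := by omega
    have hj' : j'.val < 2 ^ l := by omega
    rw [ih (i' := ⟨i'.val, hi'⟩) (j' := ⟨j'.val, hj'⟩) hi hj]
    simp only [sylvesterHadamard, reindex_apply, submatrix_apply]
    have key : ∀ (h : 2 ^ l + 2 ^ l = 2 ^ (l + 1)) (a : Fin (2 ^ (l + 1))) (ha : a.val < 2 ^ l),
        (finSumFinEquiv.trans (finCongr h)).symm a = Sum.inl ⟨a.val, ha⟩ := by
      intro h a ha
      rw [Equiv.symm_apply_eq]
      exact Fin.ext (by simp)
    rw [key _ i' hi', key _ j' hj', fromBlocks_apply₁₁]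

end Sylvester

/-! ### Rank factorization -/

section RankFactorization

/-- A real matrix of rank `r` consists of inner products of vectors of `ℝ^r`. -/
theorem exists_apply_eq_dotProduct {m n : Type*} [Fintype m] [Fintype n] [DecidableEq n]
    (M : Matrix m n ℝ) :
    ∃ (x : m → Fin M.rank → ℝ) (y : n → Fin M.rank → ℝ), ∀ i j, M i j = x i ⬝ᵥ y j := by
  let b : Module.Basis (Fin M.rank) ℝ (LinearMap.range M.mulVecLin) :=
    Module.finBasisOfFinrankEq ℝ _ rfl
  let c : n → LinearMap.range M.mulVecLin := fun j =>
    ⟨M *ᵥ Pi.single j 1, ⟨Pi.single j 1, rfl⟩⟩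
  refine ⟨fun i k => (b k : m → ℝ) i, fun j k => b.repr (c j) k, fun i j => ?_⟩
  have h1 := congrArg (fun w : LinearMap.range M.mulVecLin => (w : m → ℝ) i) (b.sum_repr (c j))
  have h2 : (c j : m → ℝ) i = M i j := by simp [c]
  simp only [h2, Submodule.coe_sum, Finset.sum_apply, Submodule.coe_smul, Pi.smul_apply,
    smul_eq_mul] at h1
  rw [← h1]
  exact Finset.sum_congr rfl fun k _ => mul_comm _ _

end RankFactorization

/-! ### Pairs of consecutive strategies -/

section Pairs

variable {n : ℕ}

theorem pairFst_ne_pairSnd (i j : Fin (n / 2)) : pairFst i ≠ pairSnd j := by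
  intro h
  have := congrArg Fin.val h
  simp only [pairFst, pairSnd] at this
  omega

theorem pairFst_injective : Function.Injective (pairFst : Fin (n / 2) → Fin n) := by
  intro i j h
  have := congrArg Fin.val h
  simp only [pairFst] at this
  exact Fin.ext (by omega)

theorem pairSnd_injective : Function.Injective (pairSnd : Fin (n / 2) → Fin n) := by
  intro i j h
  have := congrArg Fin.val h
  simp only [pairSnd] at this
  exact Fin.ext (by omega)

theorem mem_pairSet {a : Fin n} {i : Fin (n / 2)} :
    a ∈ pairSet i ↔ a = pairFst i ∨ a = pairSnd i := by
  simp [pairSet]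

theorem pairFst_mem (i : Fin (n / 2)) : pairFst i ∈ pairSet i := mem_pairSet.2 (Or.inl rfl)

theorem pairSnd_mem (i : Fin (n / 2)) : pairSnd i ∈ pairSet i := mem_pairSet.2 (Or.inr rfl)

theorem eq_of_mem_pairSet {a : Fin n} {i j : Fin (n / 2)} (hi : a ∈ pairSet i)
    (hj : a ∈ pairSet j) : i = j := by
  rw [mem_pairSet] at hi hj
  rcases hi with rfl | rfl <;> rcases hj with h | h
  · exact pairFst_injective h
  · exact absurd h (pairFst_ne_pairSnd _ _)
  · exact absurd h.symm (pairFst_ne_pairSnd _ _)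
  · exact pairSnd_injective h

theorem pairSet_injective : Function.Injective (pairSet : Fin (n / 2) → Finset (Fin n)) :=
  fun i _ h => eq_of_mem_pairSet (pairFst_mem i) (h ▸ pairFst_mem i)

theorem card_pairSet (i : Fin (n / 2)) : (pairSet i).card = 2 :=
  Finset.card_pair (pairFst_ne_pairSnd i i)

end Pairs

/-! ### Strict equilibria of subgames -/

theorem IsStrictNash.mono {n : ℕ} {A B : Matrix (Fin n) (Fin n) ℝ} {i j : Fin n}
    {I J I' J' : Finset (Fin n)} (h : IsStrictNash A B i j I J) (hI : I' ⊆ I) (hJ : J' ⊆ J)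
    (hi : i ∈ I') (hj : j ∈ J') : IsStrictNash A B i j I' J' :=
  ⟨hi, hj, fun i' hi' => h.2.2.1 i' (hI hi'), fun j' hj' => h.2.2.2 j' (hJ hj')⟩

/-- A subgame in which some player has a single strategy has at most one strict equilibrium. -/
theorem IsStrictNash.unique_of_card_eq_one {n : ℕ} {A B : Matrix (Fin n) (Fin n) ℝ}
    {i j i' j' : Fin n} {I J : Finset (Fin n)} (h : IsStrictNash A B i j I J)
    (h' : IsStrictNash A B i' j' I J) (hIJ : I.card = 1 ∨ J.card = 1) : (i', j') = (i, j) := by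
  obtain ⟨hi, hj, hA, hB⟩ := h
  obtain ⟨hi', hj', hA', hB'⟩ := h'
  rcases hIJ with hI | hJ
  · obtain rfl : i' = i := Finset.card_le_one.1 hI.le _ hi' _ hi
    by_cases hne : j' = j
    · rw [hne]
    · exact absurd (hB j' hj' hne) (hB' j hj (Ne.symm hne)).asymm
  · obtain rfl : j' = j := Finset.card_le_one.1 hJ.le _ hj' _ hj
    by_cases hne : i' = i
    · rw [hne]
    · exact absurd (hA i' hi' hne) (hA' i hi (Ne.symm hne)).asymm

namespace DataSet

variable {n : ℕ} {T : DataSet n}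

/-! ### Splitting the observed pairs -/

section SplitPairs

theorem RationalizedBy.splitPairs {A B : Matrix (Fin n) (Fin n) ℝ} (h : T.RationalizedBy A B) :
    T.splitPairs.RationalizedBy A B := by
  rintro i j I J ⟨a, b, ⟨hab, ho⟩ | ⟨hab, ho⟩⟩ <;>
    simp only [diagTriple, offDiagTriple, Set.mem_insert_iff, Set.mem_singleton_iff,
      Prod.mk.injEq] at ho <;>
    rcases ho with ⟨⟨rfl, rfl⟩, rfl, rfl⟩ | ⟨⟨rfl, rfl⟩, rfl, rfl⟩ | ⟨⟨rfl, rfl⟩, rfl, rfl⟩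
  · exact h _ _ _ _ hab.1
  · exact (h _ _ _ _ hab.2).mono (Finset.Subset.refl _) (by simp [pairSnd_mem])
      (pairSnd_mem _) (by simp)
  · exact (h _ _ _ _ hab.2).mono (by simp [pairSnd_mem]) (Finset.Subset.refl _) (by simp)
      (pairSnd_mem _)
  · exact h _ _ _ _ hab.1
  · exact (h _ _ _ _ hab.2).mono (Finset.Subset.refl _) (by simp [pairFst_mem])
      (pairSnd_mem _) (by simp)
  · exact (h _ _ _ _ hab.2).mono (by simp [pairSnd_mem]) (Finset.Subset.refl _) (by simp)
      (pairFst_mem _)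

/-- The alternating sum of the entries of a matrix over the block `(i, j)`. -/
def blockSum (M : Matrix (Fin n) (Fin n) ℝ) (i j : Fin (n / 2)) : ℝ :=
  M (pairFst i) (pairFst j) - M (pairFst i) (pairSnd j) - M (pairSnd i) (pairFst j) +
    M (pairSnd i) (pairSnd j)

theorem DiagObserved.blockSum_pos {A B : Matrix (Fin n) (Fin n) ℝ} {i j : Fin (n / 2)}
    (hij : T.DiagObserved i j) (h : T.splitPairs.RationalizedBy A B) :
    0 < blockSum (A + B) i j := by
  have h1 := h (pairFst i) (pairFst j) (pairSet i) (pairSet j)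
    ⟨i, j, Or.inl ⟨hij, by simp [diagTriple]⟩⟩
  have h2 := h (pairSnd i) (pairSnd j) (pairSet i) {pairSnd j}
    ⟨i, j, Or.inl ⟨hij, by simp [diagTriple]⟩⟩
  have h3 := h (pairSnd i) (pairSnd j) {pairSnd i} (pairSet j)
    ⟨i, j, Or.inl ⟨hij, by simp [diagTriple]⟩⟩
  have e1 := h1.2.2.1 _ (pairSnd_mem i) (pairFst_ne_pairSnd i i).symm
  have e2 := h1.2.2.2 _ (pairSnd_mem j) (pairFst_ne_pairSnd j j).symm
  have e3 := h2.2.2.1 _ (pairFst_mem i) (pairFst_ne_pairSnd i i)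
  have e4 := h3.2.2.2 _ (pairFst_mem j) (pairFst_ne_pairSnd j j)
  simp only [blockSum, Matrix.add_apply]
  linarith

theorem OffDiagObserved.blockSum_neg {A B : Matrix (Fin n) (Fin n) ℝ} {i j : Fin (n / 2)}
    (hij : T.OffDiagObserved i j) (h : T.splitPairs.RationalizedBy A B) :
    blockSum (A + B) i j < 0 := by
  have h1 := h (pairFst i) (pairSnd j) (pairSet i) (pairSet j)
    ⟨i, j, Or.inr ⟨hij, by simp [offDiagTriple]⟩⟩
  have h2 := h (pairSnd i) (pairFst j) (pairSet i) {pairFst j}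
    ⟨i, j, Or.inr ⟨hij, by simp [offDiagTriple]⟩⟩
  have h3 := h (pairSnd i) (pairFst j) {pairSnd i} (pairSet j)
    ⟨i, j, Or.inr ⟨hij, by simp [offDiagTriple]⟩⟩
  have e1 := h1.2.2.1 _ (pairSnd_mem i) (pairFst_ne_pairSnd i i).symm
  have e2 := h1.2.2.2 _ (pairFst_mem j) (pairFst_ne_pairSnd j j)
  have e3 := h2.2.2.1 _ (pairFst_mem i) (pairFst_ne_pairSnd i i)
  have e4 := h3.2.2.2 _ (pairSnd_mem j) (pairFst_ne_pairSnd j j).symm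
  simp only [blockSum, Matrix.add_apply]
  linarith

/-- In the split data set a full block carries only its first observed choice; every other subgame
has a single row or a single column. -/
theorem splitPairs_obs_cases {i j : Fin n} {I J : Finset (Fin n)}
    (h : ((i, j), I, J) ∈ T.splitPairs.obs) :
    (∃ a b, I = pairSet a ∧ J = pairSet b ∧ i = pairFst a ∧
      (T.DiagObserved a b ∧ j = pairFst b ∨ T.OffDiagObserved a b ∧ j = pairSnd b)) ∨
    I.card = 1 ∨ J.card = 1 := by
  obtain ⟨a, b, ⟨hab, ho⟩ | ⟨hab, ho⟩⟩ := h <;>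
    simp only [diagTriple, offDiagTriple, Set.mem_insert_iff, Set.mem_singleton_iff,
      Prod.mk.injEq] at ho <;>
    rcases ho with ⟨⟨rfl, rfl⟩, rfl, rfl⟩ | ⟨⟨rfl, rfl⟩, rfl, rfl⟩ | ⟨⟨rfl, rfl⟩, rfl, rfl⟩
  · exact Or.inl ⟨a, b, rfl, rfl, rfl, Or.inl ⟨hab, rfl⟩⟩
  · exact Or.inr (Or.inr (Finset.card_singleton _))
  · exact Or.inr (Or.inl (Finset.card_singleton _))
  · exact Or.inl ⟨a, b, rfl, rfl, rfl, Or.inr ⟨hab, rfl⟩⟩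
  · exact Or.inr (Or.inr (Finset.card_singleton _))
  · exact Or.inr (Or.inl (Finset.card_singleton _))

/-- Nested observations agree: a subgame with a single row or column has only one strict
equilibrium, and a full block inside another subgame is that subgame. Taking both subgames equal
gives the uniqueness of the observed choice. -/
theorem TwoRegular.hasUniqueness_splitPairs (hT : T.TwoRegular) (hr : T.Rationalizable) :
    T.splitPairs.HasUniqueness := by
  obtain ⟨A, B, hAB⟩ := hr
  have hAB' := hAB.splitPairs
  have hnest : ∀ (i j : Fin n) (I J : Finset (Fin n)) (i' j' : Fin n) (I' J' : Finset (Fin n)),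
      ((i, j), I, J) ∈ T.splitPairs.obs → ((i', j'), I', J') ∈ T.splitPairs.obs →
      (I' ×ˢ J') ⊆ (I ×ˢ J) → (i, j) ∈ I' ×ˢ J' → (i', j') = (i, j) := by
    intro i j I J i' j' I' J' ho ho' hsub hmem
    obtain ⟨hi, hj⟩ := Finset.mem_product.1 hmem
    have hI : I' ⊆ I := fun a ha =>
      (Finset.mem_product.1 (hsub (Finset.mk_mem_product ha hj))).1
    have hJ : J' ⊆ J := fun b hb =>
      (Finset.mem_product.1 (hsub (Finset.mk_mem_product hi hb))).2
    rcases splitPairs_obs_cases ho' with ⟨a', b', rfl, rfl, rfl, hc'⟩ | hcard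
    swap
    · exact ((hAB' _ _ _ _ ho).mono hI hJ hi hj).unique_of_card_eq_one (hAB' _ _ _ _ ho') hcard
    -- both subgames are full blocks, hence the same block
    have hI2 := (Finset.card_le_card hI)
    have hJ2 := (Finset.card_le_card hJ)
    rw [card_pairSet] at hI2 hJ2
    rcases splitPairs_obs_cases ho with ⟨a, b, rfl, rfl, rfl, hc⟩ | hcard
    swap
    · omega
    obtain rfl : a' = a := eq_of_mem_pairSet (pairFst_mem a') (hI (pairFst_mem a'))
    obtain rfl : b' = b := eq_of_mem_pairSet (pairFst_mem b') (hJ (pairFst_mem b'))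
    have hx := hT.2 a' b'
    rcases hc with ⟨h1, rfl⟩ | ⟨h1, rfl⟩ <;> rcases hc' with ⟨h2, rfl⟩ | ⟨h2, rfl⟩
    · rfl
    · rcases hx with hx | hx
      · exact absurd h2 hx.2
      · exact absurd h1 hx.2
    · rcases hx with hx | hx
      · exact absurd h1 hx.2
      · exact absurd h2 hx.2
    · rfl
  refine ⟨⟨A, B, hAB'⟩, ?_, hnest⟩
  rintro I J ⟨⟨i, j⟩, hp⟩
  refine ⟨(i, j), hp, ?_⟩
  rintro ⟨i', j'⟩ hp'
  exact hnest i j I J i' j' I J hp hp' (Finset.Subset.refl _)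
    (Finset.mk_mem_product (T.splitPairs.mem_rows hp) (T.splitPairs.mem_cols hp))

theorem TwoRegular.laminar (hT : T.TwoRegular) : T.Laminar := by
  rintro I J I' J' h h' ⟨⟨⟨a, b⟩, hab⟩, hsub, -⟩
  obtain ⟨i, j, rfl, rfl⟩ := (hT.1 _ _).1 h
  obtain ⟨i', j', rfl, rfl⟩ := (hT.1 _ _).1 h'
  simp only [Finset.mem_inter, Finset.mem_product] at hab
  obtain rfl := eq_of_mem_pairSet hab.1.1 hab.2.1
  obtain rfl := eq_of_mem_pairSet hab.1.2 hab.2.2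
  exact hsub (Finset.Subset.refl _)

/-- In each block the two new subgames with a single row, respectively a single column, cross. -/
theorem TwoRegular.not_laminar_splitPairs (hT : T.TwoRegular) (hn : 2 ≤ n) :
    ¬ T.splitPairs.Laminar := by
  let a : Fin (n / 2) := ⟨0, by omega⟩
  intro hL
  have hcross : ∀ x : Fin n, x ∈ pairSet a → (∃ y ∈ pairSet a, y ≠ x) →
      SubgamesCross (pairSet a) {x} {pairSnd a} (pairSet a) := by
    rintro x hx ⟨y, hy, hyx⟩
    refine ⟨⟨(pairSnd a, x), ?_⟩, fun h => ?_, fun h => ?_⟩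
    · simp [hx, pairSnd_mem]
    · have := h (Finset.mk_mem_product (pairFst_mem a) (Finset.mem_singleton_self x))
      exact pairFst_ne_pairSnd a a
        (Finset.mem_singleton.1 (Finset.mem_product.1 this).1)
    · have := h (Finset.mk_mem_product (Finset.mem_singleton_self _) hy)
      exact hyx (Finset.mem_singleton.1 (Finset.mem_product.1 this).2)
  rcases hT.2 a a with ⟨hd, -⟩ | ⟨hd, -⟩
  · refine hL _ _ _ _ ⟨(pairSnd a, pairSnd a), a, a, Or.inl ⟨hd, ?_⟩⟩
      ⟨(pairSnd a, pairSnd a), a, a, Or.inl ⟨hd, ?_⟩⟩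
      (hcross (pairSnd a) (pairSnd_mem a) ⟨_, pairFst_mem a, pairFst_ne_pairSnd a a⟩) <;>
      simp [diagTriple]
  · refine hL _ _ _ _ ⟨(pairSnd a, pairFst a), a, a, Or.inr ⟨hd, ?_⟩⟩
      ⟨(pairSnd a, pairFst a), a, a, Or.inr ⟨hd, ?_⟩⟩
      (hcross (pairFst a) (pairFst_mem a) ⟨_, pairSnd_mem a, (pairFst_ne_pairSnd a a).symm⟩) <;>
      simp [offDiagTriple]

end SplitPairs

/-! ### The rank bound -/

section RankBound

/-- The alternating block sums of `A + B` realize the Sylvester–Hadamard sign pattern in dimension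
`rank (A + B)`, so Forster's bound applies to the largest such matrix of order at most `n / 2`. -/
theorem HasSylvesterPattern.rankAtLeast_splitPairs (hT : T.HasSylvesterPattern) (hn : 2 ≤ n) :
    T.splitPairs.RankAtLeast (1 / 2 * √n) := by
  intro A B hAB
  obtain ⟨x, y, hxy⟩ := exists_apply_eq_dotProduct (A + B)
  set k := Nat.log 2 (n / 2) with hk
  have hk1 : 2 ^ k ≤ n / 2 := Nat.pow_log_le_self 2 (by omega)
  have hk2 : n / 2 < 2 ^ (k + 1) := Nat.lt_pow_succ_log_self one_lt_two _
  let H : Matrix (Fin (2 ^ k)) (Fin (2 ^ k)) ℝ := (sylvesterHadamard k).map (Int.castRingHom ℝ)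
  have hsign : ∀ i j, H i j = 1 ∨ H i j = -1 := by
    intro i j
    rcases sylvesterHadamard_eq_one_or_neg_one k i j with h | h <;> simp [H, h]
  have horth : H * Hᵀ = (Fintype.card (Fin (2 ^ k)) : ℝ) •
      (1 : Matrix (Fin (2 ^ k)) (Fin (2 ^ k)) ℝ) := by
    have h1 := congrArg (fun M => M.map (Int.castRingHom ℝ)) (sylvesterHadamard_mul_transpose k)
    simp only [Matrix.map_mul] at h1
    refine h1.trans ?_
    ext i j
    simp only [Matrix.map_apply, Matrix.smul_apply, one_apply, Fintype.card_fin]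
    split_ifs <;> simp
  have hpos : ∀ i j : Fin (2 ^ k), 0 < H i j *
      ((x (pairFst (Fin.castLE hk1 i)) - x (pairSnd (Fin.castLE hk1 i))) ⬝ᵥ
        (y (pairFst (Fin.castLE hk1 j)) - y (pairSnd (Fin.castLE hk1 j)))) := by
    intro i j
    have h1 : (x (pairFst (Fin.castLE hk1 i)) - x (pairSnd (Fin.castLE hk1 i))) ⬝ᵥ
        (y (pairFst (Fin.castLE hk1 j)) - y (pairSnd (Fin.castLE hk1 j))) =
        blockSum (A + B) (Fin.castLE hk1 i) (Fin.castLE hk1 j) := by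
      simp only [blockSum, hxy, sub_dotProduct, dotProduct_sub]
      ring
    have h2 : sylvesterHadamard k i j = sylvesterHadamard (k + 1)
        (Fin.castLE hk2.le (Fin.castLE hk1 i)) (Fin.castLE hk2.le (Fin.castLE hk1 j)) :=
      sylvesterHadamard_apply_eq_of_val_eq rfl rfl
    rw [h1]
    rcases hT (k + 1) hk2.le (Fin.castLE hk1 i) (Fin.castLE hk1 j) with ⟨h3, h4⟩ | ⟨h3, h4⟩
    · rw [submatrix_apply, ← h2] at h3
      have h5 : H i j = 1 := by simp [H, h3]
      rw [h5, one_mul]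
      exact h4.blockSum_pos hAB
    · rw [submatrix_apply, ← h2] at h3
      have h5 : H i j = -1 := by simp [H, h3]
      rw [h5, neg_one_mul, neg_pos]
      exact h4.blockSum_neg hAB
  have hF := card_le_sq_of_hadamard_sign_realization hsign horth hpos
  rw [Fintype.card_fin] at hF
  have hle : n ≤ (2 * (A + B).rank) ^ 2 := by
    have : n ≤ 4 * 2 ^ k := by rw [pow_succ] at hk2; omega
    calc n ≤ 4 * 2 ^ k := this
      _ ≤ 4 * (A + B).rank ^ 2 := by omega
      _ = _ := by ring
  have h1 : √(n : ℝ) ≤ 2 * ((A + B).rank : ℝ) :=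
    Real.sqrt_le_iff.2 ⟨by positivity, by exact_mod_cast hle⟩
  linarith

theorem RankAtLeast.of_splitPairs {r : ℝ} (h : T.splitPairs.RankAtLeast r) : T.RankAtLeast r :=
  fun A B hAB => h A B hAB.splitPairs

end RankBound

/-! ### The data set with a given sign pattern -/

section OfSigns

/-- The 2-regular data set whose sign pattern is a given `±1` matrix `S`. -/
def ofSigns (S : Matrix (Fin (n / 2)) (Fin (n / 2)) ℤ) : DataSet n where
  obs := {o | ∃ i j : Fin (n / 2), o.2 = (pairSet i, pairSet j) ∧
    (S i j = 1 ∧ (o.1 = (pairFst i, pairFst j) ∨ o.1 = (pairSnd i, pairSnd j)) ∨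
      S i j = -1 ∧ (o.1 = (pairFst i, pairSnd j) ∨ o.1 = (pairSnd i, pairFst j)))}
  mem_rows := by
    rintro i j I J ⟨a, b, h, h'⟩
    simp only [Prod.mk.injEq] at h h'
    rw [h.1, mem_pairSet]
    tauto
  mem_cols := by
    rintro i j I J ⟨a, b, h, h'⟩
    simp only [Prod.mk.injEq] at h h'
    rw [h.2, mem_pairSet]
    tauto

variable {S : Matrix (Fin (n / 2)) (Fin (n / 2)) ℤ}

theorem mem_ofSigns_obs {p : Fin n × Fin n} {i j : Fin (n / 2)} :
    (p, pairSet i, pairSet j) ∈ (ofSigns S).obs ↔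
      (S i j = 1 ∧ (p = (pairFst i, pairFst j) ∨ p = (pairSnd i, pairSnd j)) ∨
        S i j = -1 ∧ (p = (pairFst i, pairSnd j) ∨ p = (pairSnd i, pairFst j))) := by
  constructor
  · rintro ⟨a, b, h, h'⟩
    simp only [Prod.mk.injEq] at h
    obtain rfl := pairSet_injective h.1
    obtain rfl := pairSet_injective h.2
    exact h'
  · intro h
    exact ⟨i, j, rfl, h⟩

theorem diagObserved_ofSigns {i j : Fin (n / 2)} : (ofSigns S).DiagObserved i j ↔ S i j = 1 := by
  simp only [DiagObserved, mem_ofSigns_obs, Prod.mk.injEq, pairFst_ne_pairSnd,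
    (pairFst_ne_pairSnd _ _).symm]
  simp

theorem offDiagObserved_ofSigns {i j : Fin (n / 2)} :
    (ofSigns S).OffDiagObserved i j ↔ S i j = -1 := by
  simp only [OffDiagObserved, mem_ofSigns_obs, Prod.mk.injEq, pairFst_ne_pairSnd,
    (pairFst_ne_pairSnd _ _).symm]
  simp

theorem twoRegular_ofSigns (hS : ∀ i j, S i j = 1 ∨ S i j = -1) : (ofSigns S).TwoRegular := by
  refine ⟨fun I J => ⟨?_, ?_⟩, fun i j => ?_⟩
  · rintro ⟨p, a, b, h, -⟩
    simp only [Prod.mk.injEq] at h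
    exact ⟨a, b, h⟩
  · rintro ⟨i, j, rfl, rfl⟩
    rcases hS i j with h | h
    · exact ⟨(pairFst i, pairFst j), mem_ofSigns_obs.2 (Or.inl ⟨h, Or.inl rfl⟩)⟩
    · exact ⟨(pairFst i, pairSnd j), mem_ofSigns_obs.2 (Or.inr ⟨h, Or.inl rfl⟩)⟩
  · rw [diagObserved_ofSigns, offDiagObserved_ofSigns]
    rcases hS i j with h | h
    · exact Or.inl ⟨h, by rw [h]; decide⟩
    · exact Or.inr ⟨h, by rw [h]; decide⟩

open Classical in
/-- Paying both players `1` on the observed choices and `0` elsewhere rationalizes the data. -/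
theorem rationalizable_ofSigns : (ofSigns S).Rationalizable := by
  let M : Matrix (Fin n) (Fin n) ℝ := Matrix.of fun a b =>
    if ∃ I J, ((a, b), I, J) ∈ (ofSigns S).obs then 1 else 0
  have hone : ∀ {a b I J}, ((a, b), I, J) ∈ (ofSigns S).obs → M a b = 1 := fun h =>
    if_pos ⟨_, _, h⟩
  have hzero : ∀ {a b : Fin n} {i j : Fin (n / 2)}, a ∈ pairSet i → b ∈ pairSet j →
      ((a, b), pairSet i, pairSet j) ∉ (ofSigns S).obs → M a b = 0 := by
    intro a b i j ha hb hn
    refine if_neg ?_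
    rintro ⟨I, J, h⟩
    have hI := (ofSigns S).mem_rows h
    have hJ := (ofSigns S).mem_cols h
    obtain ⟨i', j', he, -⟩ := id h
    simp only [Prod.mk.injEq] at he
    obtain ⟨rfl, rfl⟩ := he
    obtain rfl := eq_of_mem_pairSet ha hI
    obtain rfl := eq_of_mem_pairSet hb hJ
    exact hn h
  refine ⟨M, M, fun a b I J h => ⟨(ofSigns S).mem_rows h, (ofSigns S).mem_cols h,
    fun a' ha' hne => ?_, fun b' hb' hne => ?_⟩⟩
  all_goals
    have hrow := (ofSigns S).mem_rows h
    have hcol := (ofSigns S).mem_cols h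
    obtain ⟨i, j, he, -⟩ := id h
    simp only [Prod.mk.injEq] at he
    obtain ⟨rfl, rfl⟩ := he
    rw [hone h]
  · rw [hzero ha' hcol ?_]
    · exact one_pos
    · rw [mem_ofSigns_obs] at h ⊢
      have := pairFst_ne_pairSnd i i
      have := pairFst_ne_pairSnd j j
      simp only [Prod.mk.injEq] at h ⊢
      grind
  · rw [hzero hrow hb' ?_]
    · exact one_pos
    · rw [mem_ofSigns_obs] at h ⊢
      have := pairFst_ne_pairSnd i i
      have := pairFst_ne_pairSnd j j
      simp only [Prod.mk.injEq] at h ⊢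
      grind

theorem hasSylvesterPattern_ofSigns {l : ℕ} (hl : n / 2 ≤ 2 ^ l) :
    (ofSigns ((sylvesterHadamard l).submatrix (Fin.castLE hl) (Fin.castLE hl)) :
      DataSet n).HasSylvesterPattern := by
  intro k hk i j
  have h : sylvesterHadamard k (Fin.castLE hk i) (Fin.castLE hk j) =
      sylvesterHadamard l (Fin.castLE hl i) (Fin.castLE hl j) :=
    sylvesterHadamard_apply_eq_of_val_eq rfl rfl
  simp only [diagObserved_ofSigns, offDiagObserved_ofSigns, submatrix_apply, h, and_self]
  exact sylvesterHadamard_eq_one_or_neg_one l _ _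

end OfSigns

end DataSet

end

theorem theorem1 :
    ∃ c : ℝ, 0 < c ∧ ∀ n : ℕ, 2 ≤ n →
      ∃ T : DataSet n,
        T.Rationalizable ∧ T.TwoRegular ∧ T.HasSylvesterPattern ∧ T.Laminar ∧
        T.RankAtLeast (c * Real.sqrt n) ∧
        T.splitPairs.Rationalizable ∧ T.splitPairs.HasUniqueness ∧ ¬ T.splitPairs.Laminar ∧
        T.splitPairs.RankAtLeast (c * Real.sqrt n) := by
  refine ⟨1 / 2, by norm_num, fun n hn => ?_⟩
  have hl : n / 2 ≤ 2 ^ n := (Nat.div_le_self n 2).trans Nat.lt_two_pow_self.le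
  have hpat := DataSet.hasSylvesterPattern_ofSigns hl
  have hrat := DataSet.rationalizable_ofSigns
    (S := (sylvesterHadamard n).submatrix (Fin.castLE hl) (Fin.castLE hl))
  have hreg := DataSet.twoRegular_ofSigns
    (S := (sylvesterHadamard n).submatrix (Fin.castLE hl) (Fin.castLE hl))
    fun i j => sylvesterHadamard_eq_one_or_neg_one n _ _
  have huniq := hreg.hasUniqueness_splitPairs hrat
  have hrank := hpat.rankAtLeast_splitPairs hn
  exact ⟨_, hrat, hreg, hpat, hreg.laminar, hrank.of_splitPairs, huniq.1, huniq,
    hreg.not_laminar_splitPairs hn, hrank⟩
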